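/- Let $(X,\|\cdot\|)$ be a real normed space and let $p\in[0,1)$. For nonzero $x,y\in X$ let $$\alpha_p[x,y]:=\left\|\frac{x}{\|x\|^{1-p}}-\frac{y}{\|y\|^{1-p}}\right\|$$ denote the $p$-angular distance. Then the following three statements are equivalent: (i) for all $q\in(0,1]$ and all nonzero $x,y\in X$, $$\alpha_p[x,y]\le 2^{1/q}\,\frac{\|x-y\|}{\bigl(\|x\|^{(1-p)q}+\|y\|^{(1-p)q}\bigr)^{1/q}};$$ (ii) there is a real number $q>0$ such that the inequality in (i) holds for all nonzero $x,y\in X$; (iii) $(X,\|\cdot\|)$ is an inner product space, that is, the norm $\|\cdot\|$ is induced by an inner product on $X$. -/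

import Mathlib

/-- The `p`-angular distance
`α_p[x, y] = ‖ x / ‖x‖ ^ (1 - p) - y / ‖y‖ ^ (1 - p) ‖` of (nonzero) vectors of a real normed
space. -/
noncomputable def pAngularDist {X : Type*} [NormedAddCommGroup X] [NormedSpace ℝ X]
    (p : ℝ) (x y : X) : ℝ :=
  ‖(‖x‖ ^ (1 - p))⁻¹ • x - (‖y‖ ^ (1 - p))⁻¹ • y‖

/-- The given norm of the real normed space `X` is induced by an inner product: there is a real
inner product space structure on `X` whose norm is the given one and whose scalar multiplication
is the given one. -/
def NormIsInducedByInner (X : Type*) [NormedAddCommGroup X] [i : NormedSpace ℝ X] : Prop :=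
  ∃ I : InnerProductSpace ℝ X, I.toNormedSpace = i

/-!
The bound in (i) compares the `p`-angular distance with `‖x - y‖` divided by the power mean of
exponent `q` of `‖x‖ ^ (1 - p)` and `‖y‖ ^ (1 - p)`.

*From an inner product to (i).* Power means increase with the exponent, so only `q = 1` matters.
After squaring, the claim is affine in the cosine of the angle between `x` and `y`, and at
cosines `1` and `-1` it is an inequality between the numbers `‖x‖ ^ p`, `‖x‖ ^ (1 - p)`,
`‖y‖ ^ p`, `‖y‖ ^ (1 - p)`.

*From (ii) to an inner product.* Power means dominate the geometric mean. For unit vectors the bound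
applied to `l • x` and `l⁻¹ • y` therefore gives `‖l ^ p • x - l ^ (-p) • y‖ ≤ ‖l • x - l⁻¹ • y‖`;
iterating, the exponents `p ^ n` tend to `0`, and `‖x - y‖ ≤ ‖l • x - l⁻¹ • y‖`. This is Lorch's
characterization of inner product spaces (`LorchInequality`), which is proved here as follows.

* Differentiating at `l = 1`: if `‖x‖ = ‖y‖`, then `x + y` is Birkhoff-James orthogonal to `x - y`
  (`LorchInequality.birkhoffOrtho_add_sub`).
* The norm is strictly convex: a segment on which the norm is constant could be doubled
  indefinitely (`LorchInequality.eq_zero_of_norm_segment`).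
* On a line `u + t • v`, the midpoint of two points of equal norm minimizes the norm, and the minimum
  is attained only once. So the norm along the line is symmetric about that point: Birkhoff-James
  orthogonality of `u` to `v` gives `‖u + v‖ = ‖u - v‖` (`LorchInequality.norm_add_eq_norm_sub`), and
  exchanging two vectors of equal norm is an isometry of their span (`LorchInequality.norm_swap`).
* For `u ⊥ v` of norm `1` and a unit vector `w = a • u + b • v`, the isometry exchanging `u` and `w`
  sends `v` to a unit vector with coordinates `(1 - a ^ 2) / b` and `-a`. Comparing with `w`,
  strict convexity forces `(1 - a ^ 2) / b = b`. This is the Pythagorean identity, and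
  the parallelogram law follows from it; the Jordan-von Neumann theorem concludes.
-/

open Filter Topology

section Lorch

variable {X : Type*} [NormedAddCommGroup X] [NormedSpace ℝ X]

/-- Birkhoff-James orthogonality: `u` has the least norm on the line through `u` in the
direction `v`. -/
def BirkhoffOrtho (u v : X) : Prop := ∀ t : ℝ, ‖u‖ ≤ ‖u + t • v‖

variable (X) in
/-- Lorch's condition `‖x + y‖ ≤ ‖l • x + l⁻¹ • y‖` for `‖x‖ = ‖y‖` and `l > 0`, in the homogeneous
form obtained by writing `l = √(a / b)`. -/
def LorchInequality : Prop :=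
  ∀ x y : X, ‖x‖ = ‖y‖ → ∀ a b : ℝ, 0 < a → 0 < b → √(a * b) * ‖x + y‖ ≤ ‖a • x + b • y‖

/-! ### Birkhoff-James orthogonality -/

namespace BirkhoffOrtho

variable {u v : X}

theorem smul_right (h : BirkhoffOrtho u v) (c : ℝ) : BirkhoffOrtho u (c • v) := fun t => by
  rw [smul_smul]
  exact h _

theorem smul_left (h : BirkhoffOrtho u v) (c : ℝ) : BirkhoffOrtho (c • u) v := fun t => by
  rcases eq_or_ne c 0 with rfl | hc
  · simp
  have e : c • u + t • v = c • (u + (c⁻¹ * t) • v) := by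
    rw [smul_add, smul_smul, mul_inv_cancel_left₀ hc]
  rw [e, norm_smul, norm_smul]
  exact mul_le_mul_of_nonneg_left (h _) (norm_nonneg _)

end BirkhoffOrtho

theorem tendsto_norm_add_smul_cocompact (u : X) {v : X} (hv : v ≠ 0) :
    Tendsto (fun t : ℝ => ‖u + t • v‖) (cocompact ℝ) atTop := by
  have h1 : Tendsto (fun t : ℝ => ‖t‖ * ‖v‖ - ‖u‖) (cocompact ℝ) atTop :=
    tendsto_atTop_add_const_right _ _
      ((tendsto_norm_cocompact_atTop (E := ℝ)).atTop_mul_const (norm_pos_iff.2 hv))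
  refine tendsto_atTop_mono (fun t => ?_) h1
  have := norm_sub_le (u + t • v) u
  rw [add_sub_cancel_left, norm_smul] at this
  linarith

theorem exists_birkhoffOrtho_sub_smul (x y : X) : ∃ c : ℝ, BirkhoffOrtho (x - c • y) y := by
  rcases eq_or_ne y 0 with rfl | hy
  · exact ⟨0, fun t => by simp⟩
  obtain ⟨c, hc⟩ := (show Continuous fun t : ℝ => ‖x + t • y‖ by fun_prop).exists_forall_le
    (tendsto_norm_add_smul_cocompact x hy)
  refine ⟨-c, fun t => ?_⟩
  have e : x - -c • y + t • y = x + (c + t) • y := by module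
  have e0 : x - -c • y = x + c • y := by module
  rw [e, e0]
  exact hc (c + t)

/-! ### Consequences of Lorch's inequality -/

namespace LorchInequality

variable (hL : LorchInequality X)

include hL

theorem birkhoffOrtho_add_sub {x y : X} (h : ‖x‖ = ‖y‖) : BirkhoffOrtho (x + y) (x - y) := by
  intro s
  -- The first order comparison at distance `e` from `x + y`, divided by `e`.
  have key : ∀ᶠ e : ℝ in 𝓝[>] 0,
      ‖x + y‖ - e * (s ^ 2 * ‖x + y‖) ≤ ‖(x + y) + s • (x - y)‖ := by
    have h1 : ∀ᶠ e : ℝ in 𝓝[>] 0, e < 1 :=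
      nhdsWithin_le_nhds (Iio_mem_nhds one_pos)
    have h2 : ∀ᶠ e : ℝ in 𝓝[>] 0, |e * s| < 1 := by
      apply nhdsWithin_le_nhds
      have : Tendsto (fun e : ℝ => |e * s|) (𝓝 0) (𝓝 |0 * s|) :=
        (show Continuous fun e : ℝ => |e * s| by fun_prop).tendsto 0
      exact this.eventually_lt_const (by simp)
    filter_upwards [h1, h2, self_mem_nhdsWithin] with e he1 he2 he0
    have he0 : 0 < e := he0
    obtain ⟨h3, h4⟩ := abs_lt.1 he2
    have h5 := hL x y h (1 + e * s) (1 - e * s) (by linarith) (by linarith)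
    have h6 : 1 - (e * s) ^ 2 ≤ √((1 + e * s) * (1 - e * s)) := by
      apply Real.le_sqrt_of_sq_le
      nlinarith [sq_nonneg (e * s), mul_pos (by linarith : 0 < 1 + e * s)
        (by linarith : 0 < 1 - e * s)]
    have e1 : (1 + e * s) • x + (1 - e * s) • y
        = (1 - e) • (x + y) + e • ((x + y) + s • (x - y)) := by module
    have h7 := norm_add_le ((1 - e) • (x + y)) (e • ((x + y) + s • (x - y)))
    rw [norm_smul, norm_smul, Real.norm_of_nonneg he0.le,
      Real.norm_of_nonneg (by linarith : 0 ≤ 1 - e)] at h7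
    rw [e1] at h5
    have h8 := mul_le_mul_of_nonneg_right h6 (norm_nonneg (x + y))
    have h9 : e * (‖x + y‖ - e * (s ^ 2 * ‖x + y‖)) ≤ e * ‖(x + y) + s • (x - y)‖ := by
      linarith
    exact le_of_mul_le_mul_left h9 he0
  have lim : Tendsto (fun e : ℝ => ‖x + y‖ - e * (s ^ 2 * ‖x + y‖)) (𝓝[>] 0)
      (𝓝 (‖x + y‖ - 0 * (s ^ 2 * ‖x + y‖))) :=
    ((show Continuous fun e : ℝ => ‖x + y‖ - e * (s ^ 2 * ‖x + y‖) by fun_prop).tendsto 0).mono_left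
      nhdsWithin_le_nhds
  rw [zero_mul, sub_zero] at lim
  exact le_of_tendsto lim key

/-- A segment of constant norm stays of constant norm when it is extended to twice its length. -/
theorem norm_segment_double {u v : X} (h : ∀ c ∈ Set.Icc (0 : ℝ) 1, ‖u + c • v‖ = ‖u‖) :
    ∀ c ∈ Set.Icc (0 : ℝ) 1, ‖u + c • (2 : ℝ) • v‖ = ‖u‖ := by
  rcases eq_or_ne u 0 with rfl | hu
  · have := h 1 (by simp)
    simp only [one_smul, zero_add, norm_zero, norm_eq_zero] at this
    simp [this]
  have hr : 0 < ‖u‖ := norm_pos_iff.2 hu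
  have hone : ‖u + v‖ = ‖u‖ := by simpa using h 1 (by simp)
  -- At a point `u + c • v` with `c ≥ 1`, the norm is at least `‖u‖` by convexity.
  have low : ∀ c : ℝ, 1 ≤ c → ‖u‖ ≤ ‖u + c • v‖ := fun c hc => by
    have e : c • (u + v) = (c - 1) • u + (u + c • v) := by module
    have := norm_add_le ((c - 1) • u) (u + c • v)
    rw [← e, norm_smul, norm_smul, hone, Real.norm_of_nonneg (by linarith : 0 ≤ c),
      Real.norm_of_nonneg (by linarith : 0 ≤ c - 1)] at this
    linarith
  have two : ‖u + (2 : ℝ) • v‖ ≤ ‖u‖ := by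
    -- Otherwise Lorch's inequality fails for `x = u + 2 • v`, `y = m • u`, `a = m`, `b = 1`, where
    -- `m > 1` makes the norms of `x` and `y` equal: it reduces to `√m * (1 + m) ≤ 2 * m`.
    set k := ‖u + (2 : ℝ) • v‖ with hk
    by_contra! hlt
    set m := k / ‖u‖ with hm
    have hm1 : 1 < m := (one_lt_div hr).2 hlt
    have hkm : k = m * ‖u‖ := by rw [hm, div_mul_cancel₀ _ hr.ne']
    have h1 := hL (u + (2 : ℝ) • v) (m • u)
      (by rw [norm_smul, Real.norm_of_nonneg (by linarith), ← hk, hkm]) m 1 (by linarith) one_pos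
    have e1 : m • (u + (2 : ℝ) • v) + (1 : ℝ) • m • u = (2 * m) • (u + v) := by module
    have e2 : (u + (2 : ℝ) • v) + m • u = (1 + m) • (u + (2 / (1 + m)) • v) := by
      rw [smul_add, smul_smul, mul_div_cancel₀ _ (by linarith : (1 + m) ≠ 0)]
      module
    have h2 := h (2 / (1 + m)) ⟨by positivity, (div_le_one (by linarith)).2 (by linarith)⟩
    rw [e1, e2, norm_smul, norm_smul, hone, h2, mul_one, Real.norm_of_nonneg (by linarith),
      Real.norm_of_nonneg (by linarith), ← mul_assoc] at h1
    have h3 := le_of_mul_le_mul_right h1 hr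
    have hs := Real.mul_self_sqrt (by linarith : 0 ≤ m)
    have hs1 : 1 < √m := by
      rw [Real.lt_sqrt zero_le_one]
      linarith
    nlinarith [mul_pos (by linarith : 0 < √m) (pow_pos (sub_pos.2 hs1) 2)]
  intro c hc
  rcases le_total (c * 2) 1 with h1 | h1
  · rw [smul_smul]
    exact h _ ⟨by linarith [hc.1], h1⟩
  · refine le_antisymm ?_ (by rw [smul_smul]; exact low _ h1)
    have e : u + c • (2 : ℝ) • v = (1 - c) • u + c • (u + (2 : ℝ) • v) := by module
    have := norm_add_le ((1 - c) • u) (c • (u + (2 : ℝ) • v))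
    rw [← e, norm_smul, norm_smul, Real.norm_of_nonneg hc.1,
      Real.norm_of_nonneg (by linarith [hc.2] : 0 ≤ 1 - c)] at this
    nlinarith [mul_le_mul_of_nonneg_left two hc.1]

theorem eq_zero_of_norm_segment {u v : X} (h : ∀ c ∈ Set.Icc (0 : ℝ) 1, ‖u + c • v‖ = ‖u‖) :
    v = 0 := by
  have h1 : ∀ n : ℕ, ∀ c ∈ Set.Icc (0 : ℝ) 1, ‖u + c • (2 : ℝ) ^ n • v‖ = ‖u‖ := by
    intro n
    induction n with
    | zero => simpa using h
    | succ n ih =>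
      have := hL.norm_segment_double ih
      rwa [smul_smul, ← pow_succ'] at this
  by_contra hv
  obtain ⟨n, hn⟩ := pow_unbounded_of_one_lt (2 * ‖u‖ / ‖v‖) (one_lt_two (α := ℝ))
  rw [div_lt_iff₀ (norm_pos_iff.2 hv)] at hn
  have h2 := h1 n 1 (by simp)
  have h3 := norm_sub_le (u + (1 : ℝ) • (2 : ℝ) ^ n • v) u
  rw [h2, add_sub_cancel_left, one_smul, norm_smul, norm_pow, Real.norm_two] at h3
  linarith

theorem norm_lt_norm_add {u v : X} (h : BirkhoffOrtho u v) (hv : v ≠ 0) : ‖u‖ < ‖u + v‖ := by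
  refine lt_of_le_of_ne (by simpa using h 1) fun heq => hv ?_
  refine hL.eq_zero_of_norm_segment fun c hc => le_antisymm ?_ (h c)
  have e : u + c • v = (1 - c) • u + c • (u + v) := by module
  have := norm_add_le ((1 - c) • u) (c • (u + v))
  rw [← e, norm_smul, norm_smul, Real.norm_of_nonneg hc.1, ← heq,
    Real.norm_of_nonneg (by linarith [hc.2] : 0 ≤ 1 - c)] at this
  linarith

theorem norm_add_smul_lt {u v : X} (h : BirkhoffOrtho u v) (hv : v ≠ 0) {s t : ℝ} (hs : 0 ≤ s)
    (hst : s < t) : ‖u + s • v‖ < ‖u + t • v‖ := by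
  have ht : 0 < t := hs.trans_lt hst
  have h1 : ‖u‖ < ‖u + t • v‖ := hL.norm_lt_norm_add (h.smul_right t) (smul_ne_zero ht.ne' hv)
  have e : t • (u + s • v) = (t - s) • u + s • (u + t • v) := by module
  have := norm_add_le ((t - s) • u) (s • (u + t • v))
  rw [← e, norm_smul, norm_smul, norm_smul, Real.norm_of_nonneg hs, Real.norm_of_nonneg ht.le,
    Real.norm_of_nonneg (by linarith : 0 ≤ t - s)] at this
  refine lt_of_mul_lt_mul_left (this.trans_lt ?_) ht.le
  nlinarith [mul_lt_mul_of_pos_left h1 (sub_pos.2 hst)]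

theorem eq_of_norm_add_smul_eq {u v : X} (h : BirkhoffOrtho u v) (hv : v ≠ 0) {s t : ℝ}
    (hs : 0 ≤ s) (ht : 0 ≤ t) (heq : ‖u + s • v‖ = ‖u + t • v‖) : s = t := by
  rcases lt_trichotomy s t with hst | hst | hst
  · exact absurd heq (hL.norm_add_smul_lt h hv hs hst).ne
  · exact hst
  · exact absurd heq (hL.norm_add_smul_lt h hv ht hst).ne'

/-- The norm is symmetric on a line about the point where it is least. -/
theorem norm_add_eq_norm_sub {u v : X} (h : BirkhoffOrtho u v) : ‖u + v‖ = ‖u - v‖ := by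
  rcases eq_or_ne v 0 with rfl | hv
  · simp
  have hcont : Continuous fun t : ℝ => ‖u + t • (-v)‖ := by fun_prop
  have hlim : Tendsto (fun t : ℝ => ‖u + t • (-v)‖) atTop atTop :=
    (tendsto_norm_add_smul_cocompact u (neg_ne_zero.2 hv)).mono_left atTop_le_cocompact
  obtain ⟨T, hT, hT0⟩ :=
    ((hlim.eventually_ge_atTop ‖u + v‖).and (eventually_ge_atTop (0 : ℝ))).exists
  obtain ⟨t, ⟨ht1, -⟩, ht⟩ := intermediate_value_Icc hT0 hcont.continuousOn
    (show ‖u + v‖ ∈ Set.Icc _ _ from ⟨by simpa using h 1, hT⟩)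
  have h1 := hL.birkhoffOrtho_add_sub ht.symm
  -- The midpoint of `u + v` and `u - t • v` is a point of least norm of the line, hence is `u`.
  have ht0 : t = 1 := by
    by_contra hne
    have h2 := hL.norm_lt_norm_add (h.smul_right ((1 - t) / 2))
      (smul_ne_zero (by intro h0; apply hne; linarith) hv)
    have hne' : 1 + t ≠ 0 := by linarith
    have h3 := h1 (-((1 - t) / (1 + t)))
    have e1 : (u + v) + (u + t • (-v)) = (2 : ℝ) • (u + ((1 - t) / 2) • v) := by module
    have e2 : (u + v) + (u + t • (-v)) + (-((1 - t) / (1 + t))) • ((u + v) - (u + t • (-v)))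
        = (2 : ℝ) • u := by
      have : (u + v) - (u + t • (-v)) = (1 + t) • v := by module
      rw [this, smul_smul, neg_mul, div_mul_cancel₀ _ hne']
      module
    rw [e2, e1, norm_smul, norm_smul] at h3
    linarith [le_of_mul_le_mul_left h3 (by simp)]
  simpa [ht0, sub_eq_add_neg] using ht.symm

/-- Ficken's symmetry: exchanging two vectors of equal norm is an isometry of their span. -/
theorem norm_swap {x y : X} (h : ‖x‖ = ‖y‖) (a b : ℝ) : ‖a • x + b • y‖ = ‖b • x + a • y‖ := by
  have h1 := hL.norm_add_eq_norm_sub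
    (((hL.birkhoffOrtho_add_sub h).smul_left ((a + b) / 2)).smul_right ((a - b) / 2))
  convert h1 using 2 <;> module

/-- The Pythagorean identity for the coordinates of a unit vector in an orthonormal basis of a
plane. -/
theorem sq_add_sq_eq_one {u v : X} (hu : ‖u‖ = 1) (hv : ‖v‖ = 1) (h : BirkhoffOrtho u v) {a b : ℝ}
    (hb : 0 < b) (hw : ‖a • u + b • v‖ = 1) : a ^ 2 + b ^ 2 = 1 := by
  have hv0 : v ≠ 0 := by
    rintro rfl
    simp at hv
  have ha : a ^ 2 ≤ 1 := by
    have := h.smul_left a b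
    rw [hw, norm_smul, hu, mul_one] at this
    exact (sq_le_one_iff_abs_le_one a).2 this
  -- The image of `v` under the isometry exchanging `u` and `w = a • u + b • v`.
  have h1 := hL.norm_swap (hu.trans hw.symm) (-(a / b)) b⁻¹
  have e1 : (-(a / b)) • u + b⁻¹ • (a • u + b • v) = v := by
    rw [smul_add, smul_smul, smul_smul, inv_mul_cancel₀ hb.ne', div_eq_inv_mul]
    module
  have e2 : b⁻¹ • u + (-(a / b)) • (a • u + b • v) = ((1 - a ^ 2) / b) • u - a • v := by
    rw [smul_add, smul_smul, smul_smul, neg_mul, neg_mul, div_mul_cancel₀ _ hb.ne']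
    have : b⁻¹ = (1 - a ^ 2) / b + a / b * a := by
      field_simp
      ring
    rw [this]
    module
  rw [e1, e2, hv, ← hL.norm_add_eq_norm_sub ((h.smul_left _).smul_right _),
    hL.norm_swap (hu.trans hv.symm)] at h1
  have h2 := hL.eq_of_norm_add_smul_eq (h.smul_left a) hv0 hb.le
    (div_nonneg (by linarith) hb.le) (hw.trans h1)
  rw [eq_div_iff hb.ne'] at h2
  linarith

theorem norm_add_sq {u v : X} (h : BirkhoffOrtho u v) : ‖u + v‖ ^ 2 = ‖u‖ ^ 2 + ‖v‖ ^ 2 := by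
  rcases eq_or_ne u 0 with rfl | hu
  · simp
  rcases eq_or_ne v 0 with rfl | hv
  · simp
  have hw : 0 < ‖u + v‖ := (norm_nonneg u).trans_lt (hL.norm_lt_norm_add h hv)
  have hu' := norm_pos_iff.2 hu
  have hv' := norm_pos_iff.2 hv
  have key := hL.sq_add_sq_eq_one (u := ‖u‖⁻¹ • u) (v := ‖v‖⁻¹ • v) (a := ‖u‖ / ‖u + v‖)
    (b := ‖v‖ / ‖u + v‖) (by rw [norm_smul, norm_inv, norm_norm, inv_mul_cancel₀ hu'.ne'])
    (by rw [norm_smul, norm_inv, norm_norm, inv_mul_cancel₀ hv'.ne'])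
    ((h.smul_left _).smul_right _) (by positivity) (by
      have e : (‖u‖ / ‖u + v‖) • ‖u‖⁻¹ • u + (‖v‖ / ‖u + v‖) • ‖v‖⁻¹ • v = ‖u + v‖⁻¹ • (u + v) := by
        rw [smul_smul, smul_smul, smul_add]
        congr 2 <;> field_simp
      rw [e, norm_smul, norm_inv, norm_norm, inv_mul_cancel₀ hw.ne'])
  field_simp at key
  linarith

theorem innerProductSpaceable : InnerProductSpaceable X := by
  refine ⟨fun x y => ?_⟩
  obtain ⟨c, hc⟩ := exists_birkhoffOrtho_sub_smul x y
  have key : ∀ t : ℝ, ‖(x - c • y) + t • y‖ ^ 2 = ‖x - c • y‖ ^ 2 + t ^ 2 * ‖y‖ ^ 2 := fun t => by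
    rw [hL.norm_add_sq (hc.smul_right t), norm_smul, mul_pow, Real.norm_eq_abs, sq_abs]
  have h0 := key c
  have h1 := key (c + 1)
  have h2 := key (c - 1)
  rw [sub_add_cancel] at h0
  rw [show (x - c • y) + (c + 1) • y = x + y by module] at h1
  rw [show (x - c • y) + (c - 1) • y = x - y by module] at h2
  linarith

end LorchInequality

/-! ### Lorch's inequality from the bound on the angular distance -/

/-- For unit vectors `x` and `y`, the norms of `l • x` and `l⁻¹ • y` have geometric mean `1`, and the
power mean in the bound is at least that. -/
theorem norm_rpow_smul_sub_le_of_bound {p q l : ℝ} (hq : 0 < q) (hl : 0 < l) {x y : X} (hx : ‖x‖ = 1)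
    (hy : ‖y‖ = 1)
    (h : ∀ x y : X, x ≠ 0 → y ≠ 0 →
        pAngularDist p x y ≤ (2 : ℝ) ^ (1 / q) *
          (‖x - y‖ / (‖x‖ ^ ((1 - p) * q) + ‖y‖ ^ ((1 - p) * q)) ^ (1 / q))) :
    ‖l ^ p • x - (l ^ p)⁻¹ • y‖ ≤ ‖l • x - l⁻¹ • y‖ := by
  have hx0 : x ≠ 0 := by
    rintro rfl
    simp at hx
  have hy0 : y ≠ 0 := by
    rintro rfl
    simp at hy
  have h1 := h (l • x) (l⁻¹ • y) (smul_ne_zero hl.ne' hx0) (smul_ne_zero (inv_ne_zero hl.ne') hy0)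
  have nx : ‖l • x‖ = l := by rw [norm_smul, hx, mul_one, Real.norm_of_nonneg hl.le]
  have ny : ‖l⁻¹ • y‖ = l⁻¹ := by
    rw [norm_smul, hy, mul_one, Real.norm_of_nonneg (inv_pos.2 hl).le]
  have cp : (l ^ (1 - p))⁻¹ * l = l ^ p := by
    rw [Real.rpow_sub hl, Real.rpow_one, inv_div, div_mul_cancel₀ _ hl.ne']
  have cm : (l⁻¹ ^ (1 - p))⁻¹ * l⁻¹ = (l ^ p)⁻¹ := by
    rw [Real.inv_rpow hl.le, ← mul_inv, cp]
  rw [pAngularDist, nx, ny, smul_smul, smul_smul, cp, cm, Real.inv_rpow hl.le] at h1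
  refine h1.trans ?_
  have hz : 0 < l ^ ((1 - p) * q) := Real.rpow_pos_of_pos hl _
  set z := l ^ ((1 - p) * q)
  have hS : 2 ≤ z + z⁻¹ := by
    have : z + z⁻¹ - 2 = (z - 1) ^ 2 / z := by
      field_simp
      ring
    have : 0 ≤ (z - 1) ^ 2 / z := by positivity
    linarith
  have hS' := Real.rpow_le_rpow two_pos.le hS (one_div_pos.2 hq).le
  have hpos : 0 < (z + z⁻¹) ^ (1 / q) := Real.rpow_pos_of_pos (by linarith) _
  rw [mul_div_assoc', div_le_iff₀ hpos, mul_comm]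
  exact mul_le_mul_of_nonneg_left hS' (norm_nonneg _)

theorem lorchInequality_of_bound {p q : ℝ} (hp : p ∈ Set.Ico (0 : ℝ) 1) (hq : 0 < q)
    (h : ∀ x y : X, x ≠ 0 → y ≠ 0 →
        pAngularDist p x y ≤ (2 : ℝ) ^ (1 / q) *
          (‖x - y‖ / (‖x‖ ^ ((1 - p) * q) + ‖y‖ ^ ((1 - p) * q)) ^ (1 / q))) :
    LorchInequality X := by
  have iter : ∀ x y : X, ‖x‖ = 1 → ‖y‖ = 1 → ∀ l : ℝ, 0 < l → ∀ n : ℕ,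
      ‖l ^ (p ^ n) • x - (l ^ (p ^ n))⁻¹ • y‖ ≤ ‖l • x - l⁻¹ • y‖ := by
    intro x y hx hy l hl n
    induction n with
    | zero => simp
    | succ n ih =>
      have := norm_rpow_smul_sub_le_of_bound hq (Real.rpow_pos_of_pos hl (p ^ n)) hx hy h
      rw [← Real.rpow_mul hl.le, ← pow_succ] at this
      exact this.trans ih
  have unit : ∀ x y : X, ‖x‖ = 1 → ‖y‖ = 1 → ∀ l : ℝ, 0 < l → ‖x - y‖ ≤ ‖l • x - l⁻¹ • y‖ := by
    intro x y hx hy l hl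
    have h1 : Tendsto (fun n : ℕ => l ^ (p ^ n)) atTop (𝓝 1) := by
      have := (Real.continuous_const_rpow hl.ne').tendsto 0 |>.comp
        (tendsto_pow_atTop_nhds_zero_of_lt_one hp.1 hp.2)
      rwa [Real.rpow_zero] at this
    have h2 : Tendsto (fun n : ℕ => ‖l ^ (p ^ n) • x - (l ^ (p ^ n))⁻¹ • y‖) atTop
        (𝓝 ‖(1 : ℝ) • x - (1 : ℝ)⁻¹ • y‖) :=
      ((h1.smul_const x).sub ((h1.inv₀ one_ne_zero).smul_const y)).norm
    rw [inv_one, one_smul, one_smul] at h2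
    exact le_of_tendsto' h2 (iter x y hx hy l hl)
  intro x y hxy a b ha hb
  rcases eq_or_ne x 0 with rfl | hx
  · have : y = 0 := by rw [← norm_eq_zero, ← hxy, norm_zero]
    simp [this]
  have hr : 0 < ‖x‖ := norm_pos_iff.2 hx
  have h1 := unit (‖x‖⁻¹ • x) (-(‖x‖⁻¹ • y))
    (by rw [norm_smul, norm_inv, norm_norm, inv_mul_cancel₀ hr.ne'])
    (by rw [norm_neg, norm_smul, norm_inv, norm_norm, hxy, inv_mul_cancel₀ (hxy ▸ hr.ne')])
    (√a / √b) (by positivity)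
  have hab : √(a * b) = √a * √b := Real.sqrt_mul ha.le b
  have e1 : ‖x‖⁻¹ • x - -(‖x‖⁻¹ • y) = ‖x‖⁻¹ • (x + y) := by module
  have e2 : (√a / √b) • ‖x‖⁻¹ • x - (√a / √b)⁻¹ • -(‖x‖⁻¹ • y)
      = (‖x‖⁻¹ * (√(a * b))⁻¹) • (a • x + b • y) := by
    have ca : √a / √b = (√(a * b))⁻¹ * a := by
      rw [hab]
      field_simp
      rw [Real.sq_sqrt ha.le]
    have cb : (√a / √b)⁻¹ = (√(a * b))⁻¹ * b := by
      rw [hab]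
      field_simp
      rw [Real.sq_sqrt hb.le]
    rw [cb, ca]
    module
  have hs : 0 < √(a * b) := Real.sqrt_pos.2 (mul_pos ha hb)
  rw [e1, e2, norm_smul, norm_smul, norm_mul, norm_inv, norm_norm, mul_assoc, norm_inv,
    Real.norm_of_nonneg hs.le] at h1
  have h2 := le_of_mul_le_mul_left h1 (inv_pos.2 hr)
  rwa [le_inv_mul_iff₀ hs] at h2

end Lorch

/-! ### The bound in an inner product space -/

/-- Monotonicity of power means, between the exponents `q ≤ 1` and `1`. -/
theorem rpow_add_rpow_le_two_rpow_mul {q a b : ℝ} (hq : q ∈ Set.Ioc (0 : ℝ) 1) (ha : 0 < a)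
    (hb : 0 < b) : (a ^ q + b ^ q) ^ (1 / q) ≤ 2 ^ (1 / q) * ((a + b) / 2) := by
  have hc := (Real.concaveOn_rpow hq.1.le hq.2).2 (Set.mem_Ici.2 ha.le) (Set.mem_Ici.2 hb.le)
    (by norm_num : (0 : ℝ) ≤ 1 / 2) (by norm_num : (0 : ℝ) ≤ 1 / 2) (by norm_num)
  simp only [smul_eq_mul] at hc
  have h1 : a ^ q + b ^ q ≤ 2 * ((a + b) / 2) ^ q := by
    rw [show (a + b) / 2 = 1 / 2 * a + 1 / 2 * b by ring]
    linarith
  have h2 := Real.rpow_le_rpow (by positivity) h1 (one_div_pos.2 hq.1).le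
  rwa [Real.mul_rpow two_pos.le (by positivity), ← Real.rpow_mul (by positivity),
    mul_one_div_cancel hq.1.ne', Real.rpow_one] at h2

/-- The squared bound for `q = 1`. Here `A, C` stand for `‖x‖ ^ p, ‖x‖ ^ (1 - p)`, likewise `B, D`
for `y`, and `c` for the cosine of the angle between `x` and `y`. -/
theorem sq_add_sq_sub_mul_le {A B C D c : ℝ} (hA : 0 < A) (hB : 0 < B) (hC : 0 < C) (hD : 0 < D)
    (hc : |c| ≤ 1) (h : (B ≤ A ∧ D ≤ C) ∨ (A ≤ B ∧ C ≤ D)) :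
    (A ^ 2 + B ^ 2 - 2 * (A * B) * c) * (C + D) ^ 2 ≤
      4 * ((A * C) ^ 2 + (B * D) ^ 2 - 2 * (A * C * (B * D)) * c) := by
  obtain ⟨hc1, hc2⟩ := abs_le.1 hc
  have hABCD : 0 ≤ (A - B) * (C - D) := by
    rcases h with ⟨h1, h2⟩ | ⟨h1, h2⟩
    · exact mul_nonneg (by linarith) (by linarith)
    · exact mul_nonneg_of_nonpos_of_nonpos (by linarith) (by linarith)
  have hplus : ((A - B) * (C + D)) ^ 2 ≤ (2 * (A * C - B * D)) ^ 2 := by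
    rw [sq_le_sq]
    rcases h with ⟨h1, h2⟩ | ⟨h1, h2⟩
    · rw [abs_of_nonneg (mul_nonneg (by linarith) (by linarith)), abs_of_nonneg (by nlinarith)]
      nlinarith
    · rw [abs_of_nonpos (mul_nonpos_of_nonpos_of_nonneg (by linarith) (by linarith)),
        abs_of_nonpos (by nlinarith)]
      nlinarith
  have hminus : ((A + B) * (C + D)) ^ 2 ≤ (2 * (A * C + B * D)) ^ 2 :=
    pow_le_pow_left₀ (by positivity) (by linarith) 2
  -- Both sides are affine in `c`, so they are interpolated between `c = 1` and `c = -1`.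
  have h1 := mul_le_mul_of_nonneg_left hplus (by linarith : 0 ≤ (1 + c) / 2)
  have h2 := mul_le_mul_of_nonneg_left hminus (by linarith : 0 ≤ (1 - c) / 2)
  linarith

theorem pAngularDist_mul_le {X : Type*} [NormedAddCommGroup X] [InnerProductSpace ℝ X] {p : ℝ}
    (hp : p ∈ Set.Ico (0 : ℝ) 1) {x y : X} (hx : x ≠ 0) (hy : y ≠ 0) :
    pAngularDist p x y * (‖x‖ ^ (1 - p) + ‖y‖ ^ (1 - p)) ≤ 2 * ‖x - y‖ := by
  have hx' := norm_pos_iff.2 hx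
  have hy' := norm_pos_iff.2 hy
  have hA := Real.rpow_pos_of_pos hx' p
  have hB := Real.rpow_pos_of_pos hy' p
  have hC := Real.rpow_pos_of_pos hx' (1 - p)
  have hD := Real.rpow_pos_of_pos hy' (1 - p)
  have hAC : ‖x‖ ^ p * ‖x‖ ^ (1 - p) = ‖x‖ := by
    rw [← Real.rpow_add hx', add_sub_cancel, Real.rpow_one]
  have hBD : ‖y‖ ^ p * ‖y‖ ^ (1 - p) = ‖y‖ := by
    rw [← Real.rpow_add hy', add_sub_cancel, Real.rpow_one]
  have hmono : (‖y‖ ^ p ≤ ‖x‖ ^ p ∧ ‖y‖ ^ (1 - p) ≤ ‖x‖ ^ (1 - p)) ∨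
      (‖x‖ ^ p ≤ ‖y‖ ^ p ∧ ‖x‖ ^ (1 - p) ≤ ‖y‖ ^ (1 - p)) := by
    have hp' : 0 ≤ 1 - p := by linarith [hp.2]
    rcases le_total ‖y‖ ‖x‖ with h | h
    · exact .inl ⟨Real.rpow_le_rpow hy'.le h hp.1, Real.rpow_le_rpow hy'.le h hp'⟩
    · exact .inr ⟨Real.rpow_le_rpow hx'.le h hp.1, Real.rpow_le_rpow hx'.le h hp'⟩
  have key := sq_add_sq_sub_mul_le hA hB hC hD (abs_real_inner_div_norm_mul_norm_le_one x y) hmono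
  have hsub := norm_sub_sq_real x y
  have hang : pAngularDist p x y ^ 2 = (‖x‖ ^ p) ^ 2 + (‖y‖ ^ p) ^ 2 -
      2 * (‖x‖ ^ p * ‖y‖ ^ p) * (inner ℝ x y / (‖x‖ * ‖y‖)) := by
    rw [pAngularDist, norm_sub_sq_real, norm_smul, norm_smul, real_inner_smul_left,
      real_inner_smul_right, norm_inv, norm_inv, Real.norm_of_nonneg hC.le,
      Real.norm_of_nonneg hD.le]
    have hC' : (‖x‖ ^ (1 - p))⁻¹ = ‖x‖ ^ p / ‖x‖ := by
      rw [inv_eq_one_div, div_eq_div_iff hC.ne' hx'.ne', hAC, one_mul]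
    have hD' : (‖y‖ ^ (1 - p))⁻¹ = ‖y‖ ^ p / ‖y‖ := by
      rw [inv_eq_one_div, div_eq_div_iff hD.ne' hy'.ne', hBD, one_mul]
    rw [hC', hD', div_mul_cancel₀ _ hx'.ne', div_mul_cancel₀ _ hy'.ne']
    field_simp
    ring
  rw [← hang, hAC, hBD] at key
  refine le_of_pow_le_pow_left₀ two_ne_zero (by positivity) ?_
  rw [mul_pow, mul_pow, hsub]
  refine key.trans (le_of_eq ?_)
  field_simp
  ring

theorem pAngularDist_le_of_inner {X : Type*} [NormedAddCommGroup X] [InnerProductSpace ℝ X]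
    {p q : ℝ} (hp : p ∈ Set.Ico (0 : ℝ) 1) (hq : q ∈ Set.Ioc (0 : ℝ) 1) {x y : X} (hx : x ≠ 0)
    (hy : y ≠ 0) :
    pAngularDist p x y ≤ (2 : ℝ) ^ (1 / q) *
      (‖x - y‖ / (‖x‖ ^ ((1 - p) * q) + ‖y‖ ^ ((1 - p) * q)) ^ (1 / q)) := by
  have hx' := norm_pos_iff.2 hx
  have hy' := norm_pos_iff.2 hy
  have hC := Real.rpow_pos_of_pos hx' (1 - p)
  have hD := Real.rpow_pos_of_pos hy' (1 - p)
  have h1 := pAngularDist_mul_le hp hx hy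
  have h2 := rpow_add_rpow_le_two_rpow_mul hq hC hD
  rw [Real.rpow_mul hx'.le, Real.rpow_mul hy'.le, mul_div_assoc', le_div_iff₀ (by positivity)]
  have h3 : 0 ≤ pAngularDist p x y := norm_nonneg _
  calc _ ≤ pAngularDist p x y * (2 ^ (1 / q) * ((‖x‖ ^ (1 - p) + ‖y‖ ^ (1 - p)) / 2)) :=
        mul_le_mul_of_nonneg_left h2 h3
    _ = 2 ^ (1 / q) * (pAngularDist p x y * (‖x‖ ^ (1 - p) + ‖y‖ ^ (1 - p)) / 2) := by ring
    _ ≤ 2 ^ (1 / q) * ‖x - y‖ := by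
        gcongr
        linarith

/-! ### The equivalence -/

theorem theorem2p7 {X : Type*} [NormedAddCommGroup X] [NormedSpace ℝ X]
    (p : ℝ) (hp : p ∈ Set.Ico (0 : ℝ) 1) :
    List.TFAE [
      ∀ q ∈ Set.Ioc (0 : ℝ) 1, ∀ x y : X, x ≠ 0 → y ≠ 0 →
        pAngularDist p x y ≤ (2 : ℝ) ^ (1 / q) *
          (‖x - y‖ / (‖x‖ ^ ((1 - p) * q) + ‖y‖ ^ ((1 - p) * q)) ^ (1 / q)),
      ∃ q : ℝ, 0 < q ∧ ∀ x y : X, x ≠ 0 → y ≠ 0 →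
        pAngularDist p x y ≤ (2 : ℝ) ^ (1 / q) *
          (‖x - y‖ / (‖x‖ ^ ((1 - p) * q) + ‖y‖ ^ ((1 - p) * q)) ^ (1 / q)),
      NormIsInducedByInner X] := by
  tfae_have 1 → 2 := fun h => ⟨1, one_pos, h 1 (by simp)⟩
  tfae_have 2 → 3 := by
    rintro ⟨q, hq, h⟩
    have := (lorchInequality_of_bound hp hq h).innerProductSpaceable
    let I : InnerProductSpace ℝ X :=
      InnerProductSpace.ofNorm ℝ this.parallelogram_identity
    exact ⟨I, rfl⟩
  tfae_have 3 → 1 := by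
    rintro ⟨I, rfl⟩ q hq x y hx hy
    exact pAngularDist_le_of_inner hp hq hx hy
  tfae_finish
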